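/- Let $d\ge 1$ and let $\mathcal C$ be the space of locally finite simple counting measures $\eta=\sum_j\delta_{x_j}$ ($x_i\ne x_j$ for $i\neq j$) on $\mathbb R^d$, with the $\sigma$-algebra generated by the counts $M_\Lambda(\eta)=\#(\Lambda\cap\operatorname{supp}\eta)$, $\Lambda$ Borel. For a measure $\eta$ and a Borel set $\Lambda$ write $\eta_\Lambda=\eta(\cdot\cap\Lambda)$. Let $\varphi:\mathbb R^d\to[0,\infty]$ be measurable, symmetric ($\varphi(-x)=\varphi(x)$) and of compact support. Put $U(\eta)=\sum\varphi(x-y)$, the sum over all unordered pairs of distinct points $\{x,y\}\subset\operatorname{supp}\eta$, and, for $\Lambda$ bounded Borel, let $U_\Lambda(\eta)$ be the same sum over those pairs that meet $\Lambda$. For $\gamma\in\mathcal C$ let $$P_{\Lambda,\gamma}(d\eta)=Z_\Lambda(\gamma)^{-1}e^{-U_\Lambda(\eta_\Lambda+\gamma_{\Lambda^c})}\,\pi_\Lambda(d\eta),$$ where $\pi_\Lambda$ is the law of the Poisson point process of intensity one in $\Lambda$ and $Z_\Lambda(\gamma)$ is the normalizing constant. Let $P$ be the distribution of a pairwise interaction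 process for $\varphi$, that is, a probability measure on $\mathcal C$ such that * $\int f(\eta)\,P(d\eta)=\int\!\int f(\eta_\Lambda+\gamma_{\Lambda^c})\,P_{\Lambda,\gamma}(d\eta)\,P(d\gamma)$ for all bounded Borel sets $\Lambda$ of positive Lebesgue measure and all bounded measurable $f$ on $\mathcal C$; * for $P$-almost every $\gamma$, $U(\eta)<\infty$ for every finite $\eta\in\mathcal C$ with $\operatorname{supp}\eta\subset\operatorname{supp}\gamma$. Let $S\subset\mathbb R^d$ and $a>0$ be such that $\varphi(x)\ge a$ for all $x\in S$. Let $v_1,\dots,v_k>0$, and let $\Lambda_1,\dots,\Lambda_k\subset\mathbb R^d$ be pairwise disjoint bounded Borel sets of positive Lebesgue measure such that, for each $j$, $x-y\in S$ whenever $x,y\in\Lambda_j$. Put $v=\sum_{j=1}^k v_j 1_{\Lambda_j}$. Then $$\limsup_{t\to\infty}t^{-2}\log\Big(\int_{\mathcal C}\exp\Big(t\int_{\mathbb R^d}v(x)\,\eta(dx)\Big)P(d\eta)\Big)\le\frac1{2a}\max_{J\in K}\sum_{j\in J}v_j^2,$$ where $K$ is the set of all $J\subset\{1,\dots,k\}$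 such that for all $i\ne j$ in $J$ there are $x\in\Lambda_i$ and $y\in\Lambda_j$ with $x-y\notin S$. -/

import Mathlib

open MeasureTheory Filter Topology Bornology
open scoped ENNReal NNReal

namespace GibbsPP

/-- The Euclidean space `ℝ^d`. -/
abbrev E (d : ℕ) : Type := EuclideanSpace ℝ (Fin d)

/-- Locally finite configurations of points in `ℝ^d`. A locally finite simple counting measure
`∑ δ_{x_j}` with distinct `x_j` is identified with its support `carrier`; the measure itself is
`Config.toMeasure`. -/
@[ext]
structure Config (d : ℕ) where
  carrier : Set (E d)
  finite_inter : ∀ B : Set (E d), IsBounded B → (B ∩ carrier).Finite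

namespace Config

variable {d : ℕ}

/-- The counting measure `∑_{x ∈ supp η} δ_x`. -/
noncomputable def toMeasure (η : Config d) : Measure (E d) :=
  Measure.sum (fun x : η.carrier => Measure.dirac (x : E d))

/-- The number `M_Λ(η) = #(Λ ∩ supp η)` of points of `η` in `Λ`. -/
noncomputable def count (Λ : Set (E d)) (η : Config d) : ℕ∞ := (Λ ∩ η.carrier).encard

/-- The σ-algebra generated by all `M_Λ`, `Λ` Borel. -/
noncomputable instance : MeasurableSpace (Config d) :=
  ⨆ (Λ : Set (E d)) (_ : MeasurableSet Λ), MeasurableSpace.comap (count Λ) ⊤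

/-- The configuration `η_Λ + γ_{Λᶜ}`: the points of `η` in `Λ` and those of `γ` off `Λ`. -/
def glue (Λ : Set (E d)) (η γ : Config d) : Config d where
  carrier := (η.carrier ∩ Λ) ∪ (γ.carrier ∩ Λᶜ)
  finite_inter B hB := by
    refine ((η.finite_inter B hB).union (γ.finite_inter B hB)).subset ?_
    rintro x ⟨hx, h | h⟩
    · exact Or.inl ⟨hx, h.1⟩
    · exact Or.inr ⟨hx, h.1⟩

/-- The configuration `{x_1, …, x_n}`. -/
def ofTuple {n : ℕ} (x : Fin n → E d) : Config d where
  carrier := Set.range x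
  finite_inter _ _ := (Set.finite_range x).subset Set.inter_subset_right

theorem count_ofTuple {n : ℕ} (B : Set (E d)) (x : Fin n → E d) :
    count B (ofTuple x) = ({i | x i ∈ B ∧ ∀ j < i, x j ≠ x i} : Set (Fin n)).encard := by
  have h : B ∩ Set.range x = x '' {i | x i ∈ B ∧ ∀ j < i, x j ≠ x i} := by
    ext y
    constructor
    · rintro ⟨hy, hi⟩
      obtain ⟨i, hi, hmin⟩ := WellFounded.has_min (wellFounded_lt (α := Fin n))
        {i | x i = y} hi
      have hi' : x i = y := hi
      exact ⟨i, ⟨by rw [hi']; exact hy, fun j hj hji => hmin j (hji.trans hi') hj⟩, hi'⟩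
    · rintro ⟨i, hi, rfl⟩
      exact ⟨hi.1, i, rfl⟩
  have hinj : Set.InjOn x {i | x i ∈ B ∧ ∀ j < i, x j ≠ x i} := by
    intro i hi j hj hij
    rcases lt_trichotomy i j with h | h | h
    · exact absurd hij (hj.2 i h)
    · exact h
    · exact absurd hij.symm (hi.2 j h)
  change (B ∩ Set.range x).encard = _
  rw [h, hinj.encard_image]

/-- Measurability of `ofTuple`, so that pushing measures forward along it is meaningful. -/
theorem measurable_ofTuple (n : ℕ) : Measurable (ofTuple : (Fin n → E d) → Config d) := by
  refine Measurable.of_le_map ?_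
  refine iSup₂_le fun B hB => ?_
  rintro _ ⟨T, -, rfl⟩
  change MeasurableSet ((fun x : Fin n → E d => count B (ofTuple x)) ⁻¹' T)
  have hpat : Measurable (fun (x : Fin n → E d) (i : Fin n) =>
      (x i ∈ B ∧ ∀ j < i, x j ≠ x i)) := by
    refine measurable_pi_lambda _ fun i => measurableSet_setOfPred.1 ?_
    refine (measurable_pi_apply i hB).inter ?_
    have : {x : Fin n → E d | ∀ j < i, x j ≠ x i} =
        ⋂ (j : Fin n) (_ : j < i), {x : Fin n → E d | x j = x i}ᶜ := by
      ext x
      simp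
    change MeasurableSet {x : Fin n → E d | ∀ j < i, x j ≠ x i}
    rw [this]
    exact MeasurableSet.iInter fun j => MeasurableSet.iInter fun _ =>
      (measurableSet_eq_fun (measurable_pi_apply j) (measurable_pi_apply i)).compl
  have : (fun x : Fin n → E d => count B (ofTuple x)) =
      (fun p : Fin n → Prop => ({i | p i} : Set (Fin n)).encard) ∘
        (fun (x : Fin n → E d) (i : Fin n) => (x i ∈ B ∧ ∀ j < i, x j ≠ x i)) := by
    funext x
    exact count_ofTuple B x
  rw [this, Set.preimage_comp]
  exact hpat (Set.toFinite _).measurableSet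

end Config

variable {d : ℕ}

/-- The Poisson point process of intensity one in a bounded Borel set `Λ`, that is, the law of
`η_Λ` when `η` is the Poisson process of intensity one on `ℝ^d`: the number of points is Poisson
with parameter `|Λ|`, and given that there are `n` points they are independent and uniformly
distributed in `Λ`. Its density with respect to `dx_1 ⋯ dx_n` on `Λ^n` is `e^{-|Λ|} / n!`. -/
noncomputable def poisson (Λ : Set (E d)) : Measure (Config d) :=
  Measure.sum fun n : ℕ =>
    (ENNReal.ofReal (Real.exp (-(volume Λ).toReal)) / (n.factorial : ℝ≥0∞)) •
      (Measure.pi fun _ : Fin n => (volume : Measure (E d)).restrict Λ).map Config.ofTuple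

/-- A pair interaction `φ : ℝ^d → [0, ∞]`: measurable, symmetric, with compact support. -/
structure IsPairInteraction (φ : E d → ℝ≥0∞) : Prop where
  measurable : Measurable φ
  symm : ∀ x, φ (-x) = φ x
  hasCompactSupport : HasCompactSupport φ

open Classical in
/-- The pairwise energy `U(η) = ∑ φ(x - y)` over unordered pairs `{x, y} ⊆ supp η`, `x ≠ y`,
written as half of the sum over ordered pairs. -/
noncomputable def energy (φ : E d → ℝ≥0∞) (η : Config d) : ℝ≥0∞ :=
  2⁻¹ * ∑' x : η.carrier, ∑' y : η.carrier,
    if (x : E d) ≠ y then φ ((x : E d) - y) else 0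

open Classical in
/-- The energy `U_Λ(η)` of the unordered pairs `{x, y} ⊆ supp η`, `x ≠ y`, that meet `Λ`. For `φ`
of compact support and bounded `Λ` only points of `η` within the range of `φ` from `Λ`
contribute, so that the formula is a finite sum for infinite `η` as well. -/
noncomputable def localEnergy (φ : E d → ℝ≥0∞) (Λ : Set (E d)) (η : Config d) : ℝ≥0∞ :=
  2⁻¹ * ∑' x : η.carrier, ∑' y : η.carrier,
    if (x : E d) ≠ y ∧ ((x : E d) ∈ Λ ∨ (y : E d) ∈ Λ) then φ ((x : E d) - y) else 0

/-- The Boltzmann factor `exp (-U_Λ(η_Λ + γ_{Λᶜ}))`, with `exp (-∞) = 0`. -/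
noncomputable def boltzmann (φ : E d → ℝ≥0∞) (Λ : Set (E d)) (γ η : Config d) : ℝ≥0∞ :=
  EReal.exp (-(localEnergy φ Λ (Config.glue Λ η γ) : EReal))

/-- The normalizing constant `Z_Λ(γ)`. -/
noncomputable def partitionFn (φ : E d → ℝ≥0∞) (Λ : Set (E d)) (γ : Config d) : ℝ≥0∞ :=
  ∫⁻ η, boltzmann φ Λ γ η ∂(poisson Λ)

/-- The finite volume Gibbs measure `P_{Λ,γ}` in `Λ` with boundary condition `γ`. -/
noncomputable def localGibbs (φ : E d → ℝ≥0∞) (Λ : Set (E d)) (γ : Config d) :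
    Measure (Config d) :=
  (partitionFn φ Λ γ)⁻¹ • (poisson Λ).withDensity (boltzmann φ Λ γ)

/-- `P` is the distribution of a pairwise interaction process for `φ`: a probability measure on
configurations that satisfies the Dobrushin-Lanford-Ruelle equations and under which almost every
configuration has only finite subconfigurations of finite energy. (By adding constants, it is
the same to require the DLR equations for nonnegative or for real bounded measurable `f`.) -/
structure IsPairwiseInteractionProcess (φ : E d → ℝ≥0∞) (P : Measure (Config d)) : Prop where
  isProbabilityMeasure : IsProbabilityMeasure P
  dlr : ∀ Λ : Set (E d), MeasurableSet Λ → IsBounded Λ → 0 < volume Λ →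
    ∀ f : Config d → ℝ≥0, Measurable f → (∃ C : ℝ≥0, ∀ η, f η ≤ C) →
      ∫⁻ η, (f η : ℝ≥0∞) ∂P =
        ∫⁻ γ, ∫⁻ η, (f (Config.glue Λ η γ) : ℝ≥0∞) ∂(localGibbs φ Λ γ) ∂P
  finite_energy : ∀ᵐ γ ∂P, ∀ η : Config d, η.carrier.Finite → η.carrier ⊆ γ.carrier →
    energy φ η < ∞

open Classical in
/-- The family `K` of index sets `J` such that for all `i ≠ j` in `J` there are `x ∈ Λ_i` and
`y ∈ Λ_j` with `x - y ∉ S`. -/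
noncomputable def separableFamily {k : ℕ} (S : Set (E d)) (Λ : Fin k → Set (E d)) :
    Finset (Finset (Fin k)) :=
  Finset.univ.filter fun J => ∀ i ∈ J, ∀ j ∈ J, i ≠ j → ∃ x ∈ Λ i, ∃ y ∈ Λ j, x - y ∉ S

theorem separableFamily_nonempty {k : ℕ} (S : Set (E d)) (Λ : Fin k → Set (E d)) :
    (separableFamily S Λ).Nonempty :=
  ⟨∅, by simp [separableFamily]⟩

end GibbsPP

/-!
Write `N_j(η)` for the number of points of `η` in `Λ_j`, so that `∫ v dη = ∑ v_j N_j(η)`, and call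
`i` and `j` adjacent when all differences of a point of `Λ_i` and a point of `Λ_j` lie in `S`, in
one order or the other; every index is adjacent to itself. Fix a bounded window `W` of positive
volume containing all `Λ_j`. Since `φ ≥ a` on `S` and `φ` is even, the energy in `W` is at least
`(a / 2) (∑_{i ~ j} N_i N_j - ∑_i N_i)` whatever the boundary condition (`le_localEnergy`).

Testing the DLR equation in `W` on `exp (t ∑ v_j N_j)`, bounding `Z_W(γ)` below by the probability
`e^{-|W|}` that the Poisson process has no point in `W` (`le_partitionFn`), and using that `π_W` is
a probability measure, one gets
`∫ exp (t ∫ v dη) dP ≤ exp (|W| + sup_n {∑ (t v_j + a / 2) n_j - (a / 2) ∑_{i ~ j} n_i n_j})`;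
this is `lintegral_exp_le`.

The supremum is evaluated as in the Motzkin-Straus theorem (`quad_le_of_indep`). For adjacent
`i ≠ j` the quadratic form vanishes on `e_i - e_j`, so the functional is affine in this direction
and one of the coordinates `n_i`, `n_j` can be pushed to zero without decreasing it. Hence the
supremum is reached on an independent set `J`, that is, on some `J ∈ K`, where completing squares
gives at most `∑_{j ∈ J} (t v_j + a / 2)² / (2 a)`. Dividing by `t²` and letting `t → ∞` yields the
claim.
-/

namespace GibbsPP

/-! ### A weighted Motzkin-Straus inequality -/

/-- A weighted Motzkin-Straus inequality: on the nonnegative orthant, a linear functional minus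
`a / 2` times the quadratic form of a reflexive symmetric relation is at most its largest value
over vectors supported on independent sets. For an independent set `J` that value is at most
`∑_{j ∈ J} u_j ^ 2 / (2 a)`. -/
theorem quad_le_of_indep {k : ℕ} (r : Fin k → Fin k → Prop) [DecidableRel r]
    (hsymm : ∀ i j, r i j → r j i) (hrefl : ∀ i, r i i) (u : Fin k → ℝ) {a B : ℝ} (ha : 0 < a)
    (hB : ∀ J : Finset (Fin k), (∀ i ∈ J, ∀ j ∈ J, i ≠ j → ¬ r i j) →
      ∑ j ∈ J, u j ^ 2 ≤ 2 * a * B) (x : Fin k → ℝ) (hx : ∀ i, 0 ≤ x i) :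
    ∑ j, u j * x j - a / 2 * ∑ i, ∑ j, (if r i j then x i * x j else 0) ≤ B := by
  induction hn : (Finset.univ.filter fun i => x i ≠ 0).card using Nat.strong_induction_on
    generalizing x with
  | _ n ih =>
  subst hn
  set J := Finset.univ.filter fun i => x i ≠ 0 with hJ
  by_cases hind : ∀ i ∈ J, ∀ j ∈ J, i ≠ j → ¬ r i j
  · have hq : ∑ i, ∑ j, (if r i j then x i * x j else 0) = ∑ i ∈ J, x i ^ 2 := by
      rw [hJ, Finset.sum_filter]
      refine Finset.sum_congr rfl fun i _ => ?_
      rw [Finset.sum_eq_single i]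
      · rw [if_pos (hrefl i)]
        split_ifs with h
        · ring
        · simp [not_not.1 h]
      · intro j _ hji
        by_cases hi : x i = 0
        · simp [hi]
        by_cases hj : x j = 0
        · simp [hj]
        rw [if_neg (hind i (by simp [hJ, hi]) j (by simp [hJ, hj]) hji.symm)]
      · simp
    have hl : ∑ j, u j * x j = ∑ j ∈ J, u j * x j := by
      rw [hJ, Finset.sum_filter]
      refine Finset.sum_congr rfl fun i _ => ?_
      split_ifs with h
      · rfl
      · simp [not_not.1 h]
    rw [hq, hl, Finset.mul_sum, ← Finset.sum_sub_distrib]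
    have h1 : ∑ i ∈ J, (u i * x i - a / 2 * x i ^ 2) ≤ ∑ i ∈ J, u i ^ 2 / (2 * a) := by
      refine Finset.sum_le_sum fun i _ => ?_
      rw [le_div_iff₀ (by positivity)]
      -- Completing the square.
      nlinarith [sq_nonneg (u i - a * x i)]
    refine h1.trans ?_
    rw [← Finset.sum_div, div_le_iff₀ (by positivity)]
    linarith [hB J hind]
  · push Not at hind
    obtain ⟨i, hi, j, hj, hij, hr⟩ := hind
    -- Moving mass along `e_i - e_j` changes the functional linearly, since the quadratic form
    -- vanishes on `e_i - e_j` for adjacent `i` and `j`.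
    let A : Matrix (Fin k) (Fin k) ℝ := fun p q => if r p q then 1 else 0
    have hA : A.transpose = A := by
      ext p q
      exact if_congr ⟨hsymm q p, hsymm p q⟩ rfl rfl
    have hf : ∀ y : Fin k → ℝ, ∑ l, u l * y l -
        a / 2 * ∑ p, ∑ q, (if r p q then y p * y q else 0) =
        u ⬝ᵥ y - a / 2 * (y ⬝ᵥ A.mulVec y) := by
      intro y
      simp only [dotProduct, Matrix.mulVec, A, Finset.mul_sum, ite_mul, mul_ite, one_mul,
        zero_mul, mul_zero]
    let w : Fin k → ℝ := Pi.single i 1 - Pi.single j 1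
    have hw : w ⬝ᵥ A.mulVec w = 0 := by
      have h11 : A i i = 1 := if_pos (hrefl i)
      have h22 : A j j = 1 := if_pos (hrefl j)
      have h12 : A i j = 1 := if_pos hr
      have h21 : A j i = 1 := if_pos (hsymm i j hr)
      simp only [w, Matrix.mulVec_sub, sub_dotProduct]
      simp [h11, h22, h12, h21]
    have hlin : ∀ s : ℝ, u ⬝ᵥ (x + s • w) - a / 2 * ((x + s • w) ⬝ᵥ A.mulVec (x + s • w)) =
        u ⬝ᵥ x - a / 2 * (x ⬝ᵥ A.mulVec x) + s * (u ⬝ᵥ w - a * (x ⬝ᵥ A.mulVec w)) := by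
      intro s
      have h2 : w ⬝ᵥ A.mulVec x = x ⬝ᵥ A.mulVec w := by
        rw [Matrix.dotProduct_mulVec, ← Matrix.mulVec_transpose, hA, dotProduct_comm]
      simp only [Matrix.mulVec_add, Matrix.mulVec_smul, add_dotProduct, dotProduct_add,
        smul_dotProduct, dotProduct_smul, hw, h2, smul_eq_mul]
      ring
    have hval : ∀ s : ℝ, ∀ l, (x + s • w) l =
        if l = i then x i + s else if l = j then x j - s else x l := by
      intro s l
      by_cases h1 : l = i
      · subst h1; simp [w, hij]
      by_cases h2 : l = j
      · subst h2; simp [w, h1]; ring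
      simp [w, h1, h2]
    have hi0 : x i ≠ 0 := by simpa [hJ] using hi
    have hj0 : x j ≠ 0 := by simpa [hJ] using hj
    have key : ∀ s : ℝ, 0 ≤ s * (u ⬝ᵥ w - a * (x ⬝ᵥ A.mulVec w)) →
        0 ≤ x i + s → 0 ≤ x j - s → (x i + s = 0 ∨ x j - s = 0) →
        ∑ l, u l * x l - a / 2 * ∑ p, ∑ q, (if r p q then x p * x q else 0) ≤ B := by
      intro s hs h1 h2 h3
      have hnn : ∀ l, 0 ≤ (x + s • w) l := by
        intro l
        rw [hval]
        split_ifs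
        exacts [h1, h2, hx l]
      refine le_trans ?_ (ih _ (Finset.card_lt_card ?_) (x + s • w) hnn rfl)
      · rw [hf, hf, hlin]
        linarith
      · rw [Finset.ssubset_iff_of_subset]
        · rcases h3 with h3 | h3
          · exact ⟨i, hi, by simp only [Finset.mem_filter, hval]; simp [h3]⟩
          · exact ⟨j, hj, by simp only [Finset.mem_filter, hval]; simp [h3, hij.symm]⟩
        · intro l hl
          simp only [Finset.mem_filter, Finset.mem_univ, true_and, hval, hJ] at hl ⊢
          by_cases hli : l = i
          · rwa [hli]
          by_cases hlj : l = j
          · rwa [hlj]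
          simpa [hli, hlj] using hl
    -- Move in the direction in which the affine function does not decrease, until a coordinate
    -- of the support vanishes.
    rcases le_total 0 (u ⬝ᵥ w - a * (x ⬝ᵥ A.mulVec w)) with hc | hc
    · exact key (x j) (mul_nonneg (hx j) hc) (add_nonneg (hx i) (hx j)) (by simp) (by simp)
    · exact key (-x i) (mul_nonneg_of_nonpos_of_nonpos (neg_nonpos.2 (hx i)) hc) (by simp)
        (by linarith [hx i, hx j]) (by simp)

/-! ### Counts -/

variable {d : ℕ}

theorem Config.measurable_count {B : Set (E d)} (hB : MeasurableSet B) :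
    Measurable (Config.count B) := by
  have h : MeasurableSpace.comap (Config.count B) ⊤ ≤
      (inferInstance : MeasurableSpace (Config d)) :=
    le_iSup₂_of_le (f := fun (Λ : Set (E d)) (_ : MeasurableSet Λ) =>
      MeasurableSpace.comap (Config.count Λ) ⊤) B hB le_rfl
  intro T _
  exact h _ ⟨T, trivial, rfl⟩

theorem Config.toMeasure_apply_eq_encard (η : Config d) {B : Set (E d)} (hB : MeasurableSet B) :
    η.toMeasure B = ((B ∩ η.carrier).encard : ℝ≥0∞) := by
  have h : η.toMeasure = Measure.sum (fun x : η.carrier => Measure.dirac (x : E d)) := rfl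
  rw [h, Measure.sum_apply _ hB]
  simp_rw [Measure.dirac_apply' _ hB]
  rw [tsum_subtype η.carrier (fun x => B.indicator (1 : E d → ℝ≥0∞) x),
    Set.indicator_indicator, Set.inter_comm, ← tsum_subtype]
  simp

theorem Config.count_glue_of_subset {B W : Set (E d)} (h : B ⊆ W) (η γ : Config d) :
    Config.count B (Config.glue W η γ) = Config.count B η := by
  have : B ∩ (Config.glue W η γ).carrier = B ∩ η.carrier := by
    ext x
    constructor
    · rintro ⟨hB, hx | hx⟩
      · exact ⟨hB, hx.1⟩
      · exact absurd (h hB) hx.2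
    · rintro ⟨hB, hx⟩
      exact ⟨hB, Or.inl ⟨hx, h hB⟩⟩
  rw [Config.count, Config.count, this]

theorem Config.integral_sum_indicator (η : Config d) {k : ℕ} (v : Fin k → ℝ)
    {Λ : Fin k → Set (E d)} (hΛm : ∀ j, MeasurableSet (Λ j)) (hΛb : ∀ j, IsBounded (Λ j)) :
    ∫ x, ∑ j, (Λ j).indicator (fun _ => v j) x ∂η.toMeasure =
      ∑ j, v j * ((Config.count (Λ j) η).toNat : ℝ) := by
  have hfin : ∀ j, η.toMeasure (Λ j) ≠ ∞ := fun j => by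
    rw [η.toMeasure_apply_eq_encard (hΛm j), (η.finite_inter _ (hΛb j)).encard_eq_coe]
    simp
  rw [integral_finsetSum _ fun j _ => (integrable_indicator_iff (hΛm j)).2
    (integrableOn_const (hfin j))]
  refine Finset.sum_congr rfl fun j _ => ?_
  rw [integral_indicator (hΛm j), setIntegral_const, smul_eq_mul, mul_comm, Measure.real,
    η.toMeasure_apply_eq_encard (hΛm j), Config.count,
    (η.finite_inter _ (hΛb j)).encard_eq_coe]
  simp

/-! ### The Poisson process and the normalizing constant -/

theorem poisson_univ {W : Set (E d)} (hW : IsBounded W) : poisson W Set.univ = 1 := by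
  obtain ⟨r, hr⟩ : ∃ r : ℝ≥0, volume W = r := ⟨(volume W).toNNReal,
    (ENNReal.coe_toNNReal hW.measure_lt_top.ne).symm⟩
  have : IsFiniteMeasure (volume.restrict W) := ⟨by simpa using hW.measure_lt_top⟩
  rw [poisson, Measure.sum_apply _ MeasurableSet.univ]
  have h : ∀ n : ℕ, ((ENNReal.ofReal (Real.exp (-(volume W).toReal)) / (n.factorial : ℝ≥0∞)) •
      (Measure.pi fun _ : Fin n => (volume : Measure (E d)).restrict W).map Config.ofTuple)
        Set.univ = ENNReal.ofReal (Real.exp (-r) * r ^ n / n.factorial) := by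
    intro n
    rw [Measure.smul_apply, Measure.map_apply (Config.measurable_ofTuple n) MeasurableSet.univ,
      Set.preimage_univ, Measure.pi_univ, ENNReal.ofReal_div_of_pos (by positivity),
      ENNReal.ofReal_mul (by positivity), ENNReal.ofReal_pow (by positivity)]
    simp [hr, div_eq_mul_inv]
    ring
  simp_rw [h]
  have hs := ProbabilityTheory.hasSum_one_poissonMeasure r
  rw [← ENNReal.ofReal_tsum_of_nonneg (fun n => by positivity) hs.summable, hs.tsum_eq,
    ENNReal.ofReal_one]

/-- The Poisson process in `W` has no point at all with probability `e^{-|W|}`, and in that case it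
has no point in `B` either. -/
theorem le_poisson_count_eq_zero {W B : Set (E d)} (hB : MeasurableSet B) :
    ENNReal.ofReal (Real.exp (-(volume W).toReal)) ≤ poisson W {η | Config.count B η = 0} := by
  have hm : MeasurableSet {η : Config d | Config.count B η = 0} :=
    Config.measurable_count hB (measurableSet_singleton 0)
  rw [poisson, Measure.sum_apply _ hm]
  refine le_trans ?_ (ENNReal.le_tsum 0)
  rw [Measure.smul_apply, Measure.map_apply (Config.measurable_ofTuple 0) hm]
  have : Config.ofTuple ⁻¹' {η : Config d | Config.count B η = 0} =
      (Set.univ : Set (Fin 0 → E d)) := by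
    ext x
    simp [Config.count, Config.ofTuple]
  rw [this, Measure.pi_univ]
  simp

/-- If `η` has no point in `W`, then no pair of points of the glued configuration meets `W`. -/
theorem boltzmann_eq_one {φ : E d → ℝ≥0∞} {W : Set (E d)} {γ η : Config d}
    (h : Config.count W η = 0) : boltzmann φ W γ η = 1 := by
  have hW : ∀ x ∈ (Config.glue W η γ).carrier, x ∉ W := by
    rintro x (hx | hx) hxW
    · have : W ∩ η.carrier = ∅ := Set.encard_eq_zero.1 h
      exact (this ▸ (⟨hxW, hx.1⟩ : x ∈ W ∩ η.carrier) : x ∈ (∅ : Set (E d)))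
    · exact hx.2 hxW
  have : localEnergy φ W (Config.glue W η γ) = 0 := by
    simp only [localEnergy]
    rw [ENNReal.tsum_eq_zero.2 fun x => ENNReal.tsum_eq_zero.2 fun y => ?_, mul_zero]
    simp [hW x x.2, hW y y.2]
  simp [boltzmann, this]

theorem le_partitionFn (φ : E d → ℝ≥0∞) {W : Set (E d)} (hW : MeasurableSet W) (γ : Config d) :
    ENNReal.ofReal (Real.exp (-(volume W).toReal)) ≤ partitionFn φ W γ := by
  have hm : MeasurableSet {η : Config d | Config.count W η = 0} :=
    Config.measurable_count hW (measurableSet_singleton 0)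
  calc _ ≤ poisson W {η | Config.count W η = 0} := le_poisson_count_eq_zero hW
    _ = ∫⁻ η in {η | Config.count W η = 0}, 1 ∂(poisson W) := by simp
    _ ≤ ∫⁻ η in {η | Config.count W η = 0}, boltzmann φ W γ η ∂(poisson W) :=
        setLIntegral_mono' hm fun η hη => (boltzmann_eq_one hη).ge
    _ ≤ _ := setLIntegral_le_lintegral _ _

/-! ### Expectations under Gibbs measures -/

/-- If a positive finite `F` times the Boltzmann factor is bounded by `C`, its expectation under the
finite volume Gibbs measure is at most `e^{|W|} C`. Measurability of the Boltzmann factor in `η`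
is not needed, as it is dominated by the measurable density `C / F`. -/
theorem lintegral_localGibbs_le {φ : E d → ℝ≥0∞} {W : Set (E d)} (hW : MeasurableSet W)
    (hWb : IsBounded W) {γ : Config d} {F : Config d → ℝ≥0∞} (hF : Measurable F)
    (hF0 : ∀ η, F η ≠ 0) (hFtop : ∀ η, F η ≠ ∞) {C : ℝ≥0∞}
    (h : ∀ η, boltzmann φ W γ η * F η ≤ C) :
    ∫⁻ η, F η ∂(localGibbs φ W γ) ≤ ENNReal.ofReal (Real.exp (volume W).toReal) * C := by
  have hle : boltzmann φ W γ ≤ fun η => C * (F η)⁻¹ := fun η =>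
    (ENNReal.le_div_iff_mul_le (Or.inl (hF0 η)) (Or.inl (hFtop η))).2 (h η)
  have hZ : (partitionFn φ W γ)⁻¹ ≤ ENNReal.ofReal (Real.exp (volume W).toReal) := by
    rw [ENNReal.inv_le_iff_inv_le, ← ENNReal.ofReal_inv_of_pos (Real.exp_pos _), ← Real.exp_neg]
    exact le_partitionFn φ hW γ
  rw [localGibbs, lintegral_smul_measure, smul_eq_mul]
  refine mul_le_mul' hZ ?_
  calc _ ≤ ∫⁻ η, F η ∂((poisson W).withDensity fun η => C * (F η)⁻¹) :=
        lintegral_mono' (withDensity_mono (ae_of_all _ hle)) le_rfl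
    _ = ∫⁻ η, C * (F η)⁻¹ * F η ∂(poisson W) :=
        lintegral_withDensity_eq_lintegral_mul _ (hF.inv.const_mul C) hF
    _ = C := by
        simp_rw [mul_assoc, ENNReal.inv_mul_cancel (hF0 _) (hFtop _), mul_one]
        rw [lintegral_const, poisson_univ hWb, mul_one]

/-- One half of the DLR equation, for unbounded `F`: the left-hand side is the supremum over simple
functions below `F`, and these are bounded. -/
theorem IsPairwiseInteractionProcess.lintegral_le {φ : E d → ℝ≥0∞} {P : Measure (Config d)}
    (hP : IsPairwiseInteractionProcess φ P) {W : Set (E d)} (hW : MeasurableSet W)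
    (hWb : IsBounded W) (hWpos : 0 < volume W) (F : Config d → ℝ≥0∞) :
    ∫⁻ η, F η ∂P ≤ ∫⁻ γ, ∫⁻ η, F (Config.glue W η γ) ∂(localGibbs φ W γ) ∂P := by
  rw [lintegral_eq_nnreal]
  refine iSup₂_le fun f hf => ?_
  rw [← SimpleFunc.lintegral_eq_lintegral]
  obtain ⟨C, hC⟩ := f.finite_range.bddAbove
  refine (hP.dlr W hW hWb hWpos f f.measurable ⟨C, fun η => hC ⟨η, rfl⟩⟩).trans_le ?_
  exact lintegral_mono fun γ => lintegral_mono fun η => hf _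

/-! ### The energy bound -/

theorem sum_le_tsum_subtype {s : Set (E d)} {T : Finset (E d)} (hT : ∀ x ∈ T, x ∈ s)
    (g : E d → ℝ≥0∞) : ∑ x ∈ T, g x ≤ ∑' x : s, g x := by
  rw [tsum_subtype]
  calc _ = ∑ x ∈ T, s.indicator g x :=
        Finset.sum_congr rfl fun x hx => (Set.indicator_of_mem (hT x hx) g).symm
    _ ≤ _ := ENNReal.sum_le_tsum _

/-- A lower bound on the energy in terms of the counts in the `Λ_j`, with the pairs ordered and the
diagonal pairs `x = y` compensated for by the last sum. -/
theorem le_localEnergy (φ : E d → ℝ≥0∞) (a : ℝ≥0∞) {k : ℕ} {Λ : Fin k → Set (E d)}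
    (hΛb : ∀ j, IsBounded (Λ j)) (hΛdisj : ∀ i j, i ≠ j → Disjoint (Λ i) (Λ j))
    (r : Fin k → Fin k → Prop) [DecidableRel r]
    (hr : ∀ i j, r i j → ∀ x ∈ Λ i, ∀ y ∈ Λ j, a ≤ φ (x - y))
    {W : Set (E d)} (hΛW : ∀ j, Λ j ⊆ W) (η : Config d) :
    (∑ i, ∑ j, if r i j then
        a * ((Config.count (Λ i) η).toNat * (Config.count (Λ j) η).toNat : ℝ≥0∞) else 0) ≤
      2 * localEnergy φ W η + a * ∑ i, ((Config.count (Λ i) η).toNat : ℝ≥0∞) := by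
  classical
  let T : Fin k → Finset (E d) := fun j => (η.finite_inter _ (hΛb j)).toFinset
  have hTmem : ∀ j x, x ∈ T j ↔ x ∈ Λ j ∧ x ∈ η.carrier := fun j x => by simp [T]
  have hTcard : ∀ j, (Config.count (Λ j) η).toNat = (T j).card := fun j => by
    rw [Config.count, (η.finite_inter _ (hΛb j)).encard_eq_coe_toFinset_card]
    rfl
  have hdisj : Set.PairwiseDisjoint ((Finset.univ : Finset (Fin k)) : Set (Fin k)) T := by
    intro i _ j _ hij
    refine Finset.disjoint_left.2 fun x hi hj => ?_
    exact Set.disjoint_left.1 (hΛdisj i j hij) ((hTmem i x).1 hi).1 ((hTmem j x).1 hj).1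
  let U := Finset.univ.biUnion T
  have hU : ∀ x ∈ U, x ∈ η.carrier ∧ x ∈ W := fun x hx => by
    obtain ⟨j, -, hj⟩ := Finset.mem_biUnion.1 hx
    exact ⟨((hTmem j x).1 hj).2, hΛW j ((hTmem j x).1 hj).1⟩
  let h : E d → E d → ℝ≥0∞ := fun x y => if x ≠ y then φ (x - y) else 0
  have h1 : ∑ x ∈ U, ∑ y ∈ U, h x y ≤ 2 * localEnergy φ W η := by
    rw [localEnergy, ← mul_assoc, ENNReal.mul_inv_cancel two_ne_zero ENNReal.ofNat_ne_top,
      one_mul]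
    let g : E d → E d → ℝ≥0∞ := fun x y => if x ≠ y ∧ (x ∈ W ∨ y ∈ W) then φ (x - y) else 0
    calc _ = ∑ x ∈ U, ∑ y ∈ U, g x y := by
          refine Finset.sum_congr rfl fun x hx => Finset.sum_congr rfl fun y _ => ?_
          simp [h, g, (hU x hx).2]
      _ ≤ ∑ x ∈ U, ∑' y : η.carrier, g x y := Finset.sum_le_sum fun x _ =>
          sum_le_tsum_subtype (fun y hy => (hU y hy).1) (g x)
      _ ≤ _ := sum_le_tsum_subtype (fun y hy => (hU y hy).1) fun x => ∑' y : η.carrier, g x y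
  -- The correction is spread over the diagonal pairs, so that the bound can be shown termwise.
  have h2 : a * ∑ i, ((Config.count (Λ i) η).toNat : ℝ≥0∞) =
      ∑ x ∈ U, ∑ y ∈ U, if x = y then a else 0 := by
    simp only [Finset.sum_ite_eq, hTcard]
    rw [Finset.sum_congr rfl fun x (hx : x ∈ U) => if_pos hx, Finset.sum_const,
      Finset.card_biUnion fun i hi j hj hij => hdisj hi hj hij, nsmul_eq_mul, mul_comm]
    push_cast
    rfl
  refine le_trans ?_ (add_le_add h1 le_rfl)
  rw [h2, ← Finset.sum_add_distrib, Finset.sum_biUnion hdisj]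
  refine Finset.sum_le_sum fun i _ => ?_
  rw [Finset.sum_congr rfl fun x _ => (Finset.sum_add_distrib).symm]
  rw [Finset.sum_congr rfl fun x _ => Finset.sum_biUnion hdisj, Finset.sum_comm]
  refine Finset.sum_le_sum fun j _ => ?_
  split_ifs with hij
  · calc _ = ∑ x ∈ T i, ∑ y ∈ T j, a := by
          simp only [Finset.sum_const, nsmul_eq_mul, hTcard]
          ring
      _ ≤ _ := by
          refine Finset.sum_le_sum fun x hx => Finset.sum_le_sum fun y hy => ?_
          by_cases hxy : x = y
          · simp [h, hxy]
          · simpa [h, hxy] using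
              hr i j hij x ((hTmem i x).1 hx).1 y ((hTmem j y).1 hy).1
  · exact zero_le

/-- The energy bound `le_localEnergy` for the glued configuration, exponentiated. It does not depend
on the boundary condition `γ`, since the counts inside `W` do not. -/
theorem boltzmann_le_exp (φ : E d → ℝ≥0∞) {a : ℝ} (ha : 0 ≤ a) {k : ℕ} {Λ : Fin k → Set (E d)}
    (hΛb : ∀ j, IsBounded (Λ j)) (hΛdisj : ∀ i j, i ≠ j → Disjoint (Λ i) (Λ j))
    (r : Fin k → Fin k → Prop) [DecidableRel r]
    (hr : ∀ i j, r i j → ∀ x ∈ Λ i, ∀ y ∈ Λ j, ENNReal.ofReal a ≤ φ (x - y))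
    {W : Set (E d)} (hΛW : ∀ j, Λ j ⊆ W) (γ η : Config d) :
    boltzmann φ W γ η ≤ ENNReal.ofReal (Real.exp
      (a / 2 * ∑ i, ((Config.count (Λ i) η).toNat : ℝ) -
        a / 2 * ∑ i, ∑ j, if r i j then
          ((Config.count (Λ i) η).toNat : ℝ) * ((Config.count (Λ j) η).toNat : ℝ) else 0)) := by
  have h := le_localEnergy φ (ENNReal.ofReal a) hΛb hΛdisj r hr hΛW (Config.glue W η γ)
  simp only [Config.count_glue_of_subset (hΛW _)] at h
  rw [boltzmann]
  by_cases htop : localEnergy φ W (Config.glue W η γ) = ∞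
  · simp [htop]
  obtain ⟨e, he⟩ : ∃ e : ℝ≥0, localEnergy φ W (Config.glue W η γ) = e :=
    ⟨_, (ENNReal.coe_toNNReal htop).symm⟩
  rw [he] at h ⊢
  lift a to ℝ≥0 using ha
  rw [ENNReal.ofReal_coe_nnreal] at h
  have h' : (∑ i, ∑ j, if r i j then
        a * (((Config.count (Λ i) η).toNat : ℝ≥0) * (Config.count (Λ j) η).toNat) else 0) ≤
      2 * e + a * ∑ i, ((Config.count (Λ i) η).toNat : ℝ≥0) := by
    rw [← ENNReal.coe_le_coe]
    push_cast
    simpa only [apply_ite ENNReal.ofNNReal, ENNReal.coe_mul, ENNReal.coe_natCast,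
      ENNReal.coe_zero] using h
  have h'' : (∑ i, ∑ j, if r i j then
        a * (((Config.count (Λ i) η).toNat : ℝ) * (Config.count (Λ j) η).toNat) else 0) ≤
      2 * e + a * ∑ i, ((Config.count (Λ i) η).toNat : ℝ) := by
    have h2 := NNReal.coe_le_coe.2 h'
    push_cast at h2
    simpa only [apply_ite NNReal.toReal, NNReal.coe_mul, NNReal.coe_natCast,
      NNReal.coe_zero] using h2
  have h3 : (∑ i, ∑ j, if r i j then
        a * (((Config.count (Λ i) η).toNat : ℝ) * (Config.count (Λ j) η).toNat) else 0) =
      a * ∑ i, ∑ j, if r i j then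
        ((Config.count (Λ i) η).toNat : ℝ) * (Config.count (Λ j) η).toNat else 0 := by
    simp only [Finset.mul_sum, mul_ite, mul_zero]
  rw [h3] at h''
  have : (-(((e : ℝ≥0∞)) : EReal)) = ((-(e : ℝ) : ℝ) : EReal) := rfl
  rw [this, EReal.exp_coe]
  refine ENNReal.ofReal_le_ofReal (Real.exp_le_exp.2 ?_)
  linarith

/-! ### The exponential moment -/

/-- The exponential moment bound at fixed parameters: `B` bounds the values of the exponent on
independent sets. The shift by `a / 2` of the linear coefficients comes from replacing the
`n_i (n_i - 1) / 2` pairs inside `Λ_i` by `n_i ^ 2 / 2`. -/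
theorem lintegral_exp_le {φ : E d → ℝ≥0∞} {P : Measure (Config d)}
    (hP : IsPairwiseInteractionProcess φ P) {a : ℝ} (ha : 0 < a) {k : ℕ}
    {Λ : Fin k → Set (E d)} (hΛm : ∀ j, MeasurableSet (Λ j))
    (hΛb : ∀ j, IsBounded (Λ j)) (hΛdisj : ∀ i j, i ≠ j → Disjoint (Λ i) (Λ j))
    (r : Fin k → Fin k → Prop) [DecidableRel r]
    (hsymm : ∀ i j, r i j → r j i) (hrefl : ∀ i, r i i)
    (hr : ∀ i j, r i j → ∀ x ∈ Λ i, ∀ y ∈ Λ j, ENNReal.ofReal a ≤ φ (x - y))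
    {W : Set (E d)} (hW : MeasurableSet W) (hWb : IsBounded W) (hWpos : 0 < volume W)
    (hΛW : ∀ j, Λ j ⊆ W) (u : Fin k → ℝ) {B : ℝ}
    (hB : ∀ J : Finset (Fin k), (∀ i ∈ J, ∀ j ∈ J, i ≠ j → ¬ r i j) →
      ∑ j ∈ J, (u j + a / 2) ^ 2 ≤ 2 * a * B) :
    ∫⁻ η, ENNReal.ofReal (Real.exp (∑ j, u j * ((Config.count (Λ j) η).toNat : ℝ))) ∂P ≤
      ENNReal.ofReal (Real.exp ((volume W).toReal + B)) := by
  have := hP.isProbabilityMeasure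
  have hmeas : Measurable fun η : Config d =>
      ENNReal.ofReal (Real.exp (∑ j, u j * ((Config.count (Λ j) η).toNat : ℝ))) := by
    have : ∀ j, Measurable fun η : Config d => ((Config.count (Λ j) η).toNat : ℝ) := fun j =>
      (measurable_of_countable fun n : ℕ∞ => (n.toNat : ℝ)).comp
        (Config.measurable_count (hΛm j))
    fun_prop
  refine (hP.lintegral_le hW hWb hWpos _).trans ?_
  calc _ ≤ ∫⁻ _, ENNReal.ofReal (Real.exp ((volume W).toReal + B)) ∂P := by
        refine lintegral_mono fun γ => ?_
        simp only [Config.count_glue_of_subset (hΛW _)]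
        rw [Real.exp_add, ENNReal.ofReal_mul (by positivity)]
        refine lintegral_localGibbs_le hW hWb hmeas (fun η => by simp [Real.exp_pos])
          (fun η => ENNReal.ofReal_ne_top) fun η => ?_
        refine (mul_le_mul_left
          (boltzmann_le_exp φ ha.le hΛb hΛdisj r hr hΛW γ η) _).trans ?_
        rw [← ENNReal.ofReal_mul (by positivity), ← Real.exp_add]
        refine ENNReal.ofReal_le_ofReal (Real.exp_le_exp.2 ?_)
        have hq := quad_le_of_indep r hsymm hrefl (fun j => u j + a / 2) ha hB
          (fun j => ((Config.count (Λ j) η).toNat : ℝ)) fun j => Nat.cast_nonneg _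
        simp only [add_mul, Finset.sum_add_distrib, ← Finset.mul_sum] at hq
        linarith
    _ = _ := by simp

end GibbsPP

theorem mainTheorem4 {d : ℕ} (hd : 0 < d)
    (φ : GibbsPP.E d → ℝ≥0∞) (hφ : GibbsPP.IsPairInteraction φ)
    (P : Measure (GibbsPP.Config d)) (hP : GibbsPP.IsPairwiseInteractionProcess φ P)
    (S : Set (GibbsPP.E d)) (a : ℝ) (ha : 0 < a) (haS : ∀ x ∈ S, ENNReal.ofReal a ≤ φ x)
    {k : ℕ} (v : Fin k → ℝ) (hv : ∀ j, 0 < v j)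
    (Λ : Fin k → Set (GibbsPP.E d)) (hΛm : ∀ j, MeasurableSet (Λ j))
    (hΛb : ∀ j, IsBounded (Λ j)) (hΛpos : ∀ j, 0 < volume (Λ j))
    (hΛdisj : ∀ i j, i ≠ j → Disjoint (Λ i) (Λ j))
    (hΛS : ∀ j, ∀ x ∈ Λ j, ∀ y ∈ Λ j, x - y ∈ S) :
    limsup (fun t : ℝ => (((t ^ 2)⁻¹ : ℝ) : EReal) *
        ENNReal.log (∫⁻ η, ENNReal.ofReal (Real.exp
          (t * ∫ x, ∑ j, (Λ j).indicator (fun _ => v j) x ∂η.toMeasure)) ∂P)) atTop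
      ≤ ((1 / (2 * a) * (GibbsPP.separableFamily S Λ).sup'
          (GibbsPP.separableFamily_nonempty S Λ) (fun J => ∑ j ∈ J, v j ^ 2) : ℝ) : EReal) := by
  classical
  set M := (GibbsPP.separableFamily S Λ).sup'
    (GibbsPP.separableFamily_nonempty S Λ) (fun J => ∑ j ∈ J, v j ^ 2) with hM
  -- A ball is added to the union so that it has positive volume even for `k = 0`.
  let W : Set (GibbsPP.E d) := (⋃ j, Λ j) ∪ Metric.ball 0 1
  have hW : MeasurableSet W := (MeasurableSet.iUnion hΛm).union measurableSet_ball
  have hWb : IsBounded W := (isBounded_iUnion.2 hΛb).union Metric.isBounded_ball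
  have hWpos : 0 < volume W :=
    (Metric.measure_ball_pos volume (0 : GibbsPP.E d) one_pos).trans_le
      (measure_mono Set.subset_union_right)
  have hΛW : ∀ j, Λ j ⊆ W := fun j => (Set.subset_iUnion Λ j).trans Set.subset_union_left
  let r : Fin k → Fin k → Prop := fun i j =>
    (∀ x ∈ Λ i, ∀ y ∈ Λ j, x - y ∈ S) ∨ (∀ x ∈ Λ j, ∀ y ∈ Λ i, x - y ∈ S)
  have hr : ∀ i j, r i j → ∀ x ∈ Λ i, ∀ y ∈ Λ j, ENNReal.ofReal a ≤ φ (x - y) := by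
    rintro i j (h | h) x hx y hy
    · exact haS _ (h x hx y hy)
    · rw [← hφ.symm, neg_sub]
      exact haS _ (h y hy x hx)
  -- `D` and `D'` bound the lower order terms of `∑ (t v_j + a / 2) ^ 2` over any index set.
  let D : ℝ := ∑ j, a * v j
  let D' : ℝ := ∑ _j : Fin k, a ^ 2 / 4
  have hB : ∀ t : ℝ, 0 ≤ t → ∀ J : Finset (Fin k), (∀ i ∈ J, ∀ j ∈ J, i ≠ j → ¬ r i j) →
      ∑ j ∈ J, (t * v j + a / 2) ^ 2 ≤ 2 * a * ((t ^ 2 * M + t * D + D') / (2 * a)) := by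
    intro t ht J hJ
    have hJM : ∑ j ∈ J, v j ^ 2 ≤ M := by
      refine Finset.le_sup' (fun J => ∑ j ∈ J, v j ^ 2) ?_
      simp only [GibbsPP.separableFamily, Finset.mem_filter, Finset.mem_univ, true_and]
      intro i hi j hj hij
      have := hJ i hi j hj hij
      simp only [r, not_or] at this
      simpa using this.1
    rw [mul_div_cancel₀ _ (by positivity)]
    have hD : ∑ j ∈ J, a * v j ≤ D := Finset.sum_le_sum_of_subset_of_nonneg
      (Finset.subset_univ J) fun j _ _ => (mul_pos ha (hv j)).le
    have hD' : ∑ j ∈ J, a ^ 2 / 4 ≤ D' := Finset.sum_le_sum_of_subset_of_nonneg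
      (Finset.subset_univ J) fun j _ _ => by positivity
    calc ∑ j ∈ J, (t * v j + a / 2) ^ 2
        = t ^ 2 * ∑ j ∈ J, v j ^ 2 + t * ∑ j ∈ J, a * v j + ∑ j ∈ J, a ^ 2 / 4 := by
          rw [Finset.mul_sum, Finset.mul_sum, ← Finset.sum_add_distrib,
            ← Finset.sum_add_distrib]
          exact Finset.sum_congr rfl fun j _ => by ring
      _ ≤ _ := by gcongr
  -- The bound on the logarithm of the moment, divided by `t ^ 2`.
  let b : ℝ → ℝ := fun t => 1 / (2 * a) * M + (D / (2 * a)) * t⁻¹ +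
    ((volume W).toReal + D' / (2 * a)) * (t⁻¹ * t⁻¹)
  have hlim : Tendsto (fun t => (b t : EReal)) atTop (𝓝 ((1 / (2 * a) * M : ℝ) : EReal)) := by
    refine (continuous_coe_real_ereal.tendsto _).comp ?_
    have h := tendsto_inv_atTop_zero (𝕜 := ℝ)
    have h2 := ((tendsto_const_nhds (x := 1 / (2 * a) * M)).add
      (h.const_mul (D / (2 * a)))).add
      ((h.mul h).const_mul ((volume W).toReal + D' / (2 * a)))
    simpa only [mul_zero, add_zero] using h2
  rw [← hlim.limsup_eq]
  refine limsup_le_limsup ?_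
  filter_upwards [eventually_gt_atTop 0] with t ht
  have hmain := GibbsPP.lintegral_exp_le hP ha hΛm hΛb hΛdisj r
    (fun i j h => h.symm) (fun i => Or.inl (hΛS i)) hr hW hWb hWpos hΛW (fun j => t * v j)
    (hB t ht.le)
  simp only [GibbsPP.Config.integral_sum_indicator _ v hΛm hΛb, Finset.mul_sum, ← mul_assoc]
  have hlog := ENNReal.log_le_log hmain
  rw [ENNReal.log_ofReal_of_pos (Real.exp_pos _), Real.log_exp] at hlog
  refine (mul_le_mul_of_nonneg_left hlog
    (EReal.coe_nonneg.2 (by positivity : (0 : ℝ) ≤ (t ^ 2)⁻¹))).trans ?_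
  rw [← EReal.coe_mul, EReal.coe_le_coe_iff]
  refine le_of_eq ?_
  simp only [b]
  field_simp
  ring
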